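/- A set $A\subseteq\mathbb R$ is $\aleph_1$-dense if between any two of its points it has exactly $\aleph_1$ points. An $\aleph_1$-dense set $A$ is good, witnessed by the injective enumeration $A=\{r_\xi:\xi<\omega_1\}$, if for every $n<\omega$ and every sequence $\langle a_\alpha:\alpha<\omega_1\rangle$ with $a_\alpha\in[\omega_1]^n$ there are $\alpha<\beta<\omega_1$ such that $r_{a_\alpha(i)}\le r_{a_\beta(i)}$ for all $i<n$, where $a(i)$ denotes the $i$-th element of $a$ in increasing order. A forcing poset $\mathbb P$ is appropriate for such an enumerated good set $A$ if for every $n<\omega$ and every sequence $\langle (p_\alpha,a_\alpha):\alpha<\omega_1\rangle$ with $p_\alpha\in\mathbb P$ and $a_\alpha\in[\omega_1]^n$ there are $\alpha<\beta<\omega_1$ such that $p_\alpha$ and $p_\beta$ are compatible and $r_{a_\alpha(i)}\le r_{a_\beta(i)}$ for all $i<n$. Lemma. Let $A=\{r_\xi:\xi<\omega_1\}$ be a good set of reals, let $\delta$ be an ordinal, and let $\langle \mathbb P_\alpha,\dot{\mathbb Q}_\beta:\alpha\le\delta,\ \beta<\delta\rangle$ be a finite support iteration of forcing posets of length $\delta$: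 each $\dot{\mathbb Q}_\beta$ is a $\mathbb P_\beta$-name for a forcing poset with a largest element named by $\dot 1_\beta\in\operatorname{dom}(\dot{\mathbb Q}_\beta)$; the conditions of $\mathbb P_\alpha$ are the sequences $p=\langle p(\beta):\beta<\alpha\rangle$ such that $p(\beta)\in\operatorname{dom}(\dot{\mathbb Q}_\beta)$ and $p\restriction\beta\in\mathbb P_\beta$ forces $p(\beta)\in\dot{\mathbb Q}_\beta$ for all $\beta<\alpha$, and $p(\beta)=\dot 1_\beta$ for all but finitely many $\beta<\alpha$; and $p\le q$ in $\mathbb P_\alpha$ if and only if $p\restriction\beta\Vdash p(\beta)\le q(\beta)$ for all $\beta<\alpha$. If for every $\beta<\delta$ $$\Vdash_{\mathbb P_\beta}\ \text{``}\dot{\mathbb Q}_\beta\text{ is appropriate for }\{r_\xi:\xi<\omega_1\}\text{''},$$ then $\mathbb P_\delta$ is appropriate for $A=\{r_\xi:\xi<\omega_1\}$. -/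

import Mathlib

open scoped Cardinal Ordinal

universe u

namespace FSI

/-! ### Good sets of reals and appropriate posets in the ground model -/

/-- A set of reals is `ℵ₁`-dense if between any two of its points it has exactly `ℵ₁` points. -/
def AlephOneDense (A : Set ℝ) : Prop :=
  ∀ x ∈ A, ∀ y ∈ A, x < y → #(A ∩ Set.Ioo x y : Set ℝ) = ℵ₁

/-- The countable ordinals, i.e. the elements of `ω₁`. -/
abbrev Omega1 : Type (u + 1) := Set.Iio (ω₁ : Ordinal.{u})

/-- `[ω₁]ⁿ`, the `n`-element subsets of `ω₁`. -/
abbrev Omega1Sub (n : ℕ) : Type (u + 1) := {s : Finset Omega1.{u} // s.card = n}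

/-- `a(i)`: the `i`-th element, in increasing order, of `a ∈ [ω₁]ⁿ`. -/
noncomputable def nthElt {n : ℕ} (a : Omega1Sub.{u} n) (i : Fin n) : Omega1.{u} :=
  a.1.orderEmbOfFin a.2 i

/-- `r` is an injective enumeration, in type `ω₁`, of the `ℵ₁`-dense set of reals `A`, and it
witnesses that `A` is good. -/
structure IsGoodEnumeration (A : Set ℝ) (r : Omega1.{u} → ℝ) : Prop where
  dense : AlephOneDense A
  injective : Function.Injective r
  range_eq : Set.range r = A
  good : ∀ (n : ℕ) (a : Omega1.{u} → Omega1Sub.{u} n),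
    ∃ α β, α < β ∧ ∀ i, r (nthElt (a α) i) ≤ r (nthElt (a β) i)

/-- Two conditions are compatible if they have a common extension (stronger is smaller). -/
def Compat {P : Type u} [Preorder P] (p q : P) : Prop := ∃ s, s ≤ p ∧ s ≤ q

/-- The forcing poset `P` is appropriate for the set of reals enumerated by `r`. -/
def Appropriate (r : Omega1.{u} → ℝ) (P : Type u) [Preorder P] : Prop :=
  ∀ (n : ℕ) (p : Omega1.{u} → P) (a : Omega1.{u} → Omega1Sub.{u} n),
    ∃ α β, α < β ∧ Compat (p α) (p β) ∧ ∀ i, r (nthElt (a α) i) ≤ r (nthElt (a β) i)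

/-! ### Names and the forcing relation -/

/-- `P`-names: a name is a (small) family of pairs `(σ, p)` with `σ` a name and `p ∈ P`. -/
inductive PName (P : Type u) : Type (u + 1)
  | mk (ι : Type u) (val : ι → PName P) (cond : ι → P) : PName P

/-- `dom τ`, the set of names `σ` such that `(σ, p)` belongs to `τ` for some `p`. -/
def PName.dom {P : Type u} : PName P → Set (PName P)
  | .mk _ val _ => Set.range val

/-- A statement of the forcing language of `P`, given by the conditions that force it:
`φ p` is read `p ⊩ φ`. -/
abbrev Stmt (P : Type u) : Type u := P → Prop

section Forcing

variable {P : Type u} [Preorder P]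

/-- `p ⊩ φ ∧ ψ`. -/
def fAnd (φ ψ : Stmt P) : Stmt P := fun p => φ p ∧ ψ p

/-- `p ⊩ φ → ψ`: every extension of `p` that forces `φ` forces `ψ`. -/
def fImp (φ ψ : Stmt P) : Stmt P := fun p => ∀ q ≤ p, φ q → ψ q

/-- `p ⊩ ∀ x, φ x`. -/
def fAll {X : Type*} (φ : X → Stmt P) : Stmt P := fun p => ∀ x, φ x p

/-- `p ⊩ ∃ x, φ x`: the conditions that force `φ x` for some `x` are dense below `p`. -/
def fEx {X : Type*} (φ : X → Stmt P) : Stmt P := fun p => ∀ q ≤ p, ∃ s ≤ q, ∃ x, φ x s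

/-- `p ⊩ σ = τ`, by recursion on names: `p` forces that every element of `σ` is equal to some
element of `τ`, and conversely. -/
def fEq : PName P → PName P → Stmt P
  | .mk ι v c, .mk κ w d => fun p =>
    (∀ (i : ι), ∀ q ≤ p, q ≤ c i → ∃ s ≤ q, ∃ j : κ, s ≤ d j ∧ fEq (v i) (w j) s) ∧
    (∀ (j : κ), ∀ q ≤ p, q ≤ d j → ∃ s ≤ q, ∃ i : ι, s ≤ c i ∧ fEq (v i) (w j) s)

/-- `p ⊩ σ ∈ τ`: the conditions `s` for which there is `(π, d) ∈ τ` with `s ≤ d` and `s ⊩ σ = π`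
are dense below `p`. -/
def fMem (σ : PName P) : PName P → Stmt P
  | .mk κ w d => fun p => ∀ q ≤ p, ∃ s ≤ q, ∃ j : κ, s ≤ d j ∧ fEq σ (w j) s

/-- The bounded quantifier `∀ x ∈ τ, φ x`. -/
def fBall (τ : PName P) (φ : PName P → Stmt P) : Stmt P :=
  fAll fun x => fImp (fMem x τ) (φ x)

/-- The bounded quantifier `∃ x ∈ τ, φ x`. -/
def fBex (τ : PName P) (φ : PName P → Stmt P) : Stmt P :=
  fEx fun x => fAnd (fMem x τ) (φ x)

/-- The canonical name `x̌` of a set `x` of the ground model. Posets here need not come with a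
chosen largest element, so each `y̌` with `y ∈ x` is paired with all conditions. -/
def check (P : Type u) : PSet.{u} → PName P
  | .mk ι v => .mk (ι × P) (fun x => check P (v x.1)) (fun x => x.2)

/-- The canonical name of an ordinal. -/
noncomputable def checkOrd (P : Type u) (ξ : Ordinal.{u}) : PName P := check P ξ.toPSet

/-- The name of the unordered pair of `σ` and `τ`. -/
def upair (σ τ : PName P) : PName P :=
  .mk (ULift.{u} Bool × P) (fun x => bif x.1.down then σ else τ) (fun x => x.2)

/-- The name of the (Kuratowski) ordered pair of `σ` and `τ`. -/
def opair (σ τ : PName P) : PName P := upair (upair σ σ) (upair σ τ)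

/-- "`f` is a function from `A` to `B`". -/
def fFun (f A B : PName P) : Stmt P :=
  fAnd
    (fBall f fun z => fBex A fun x => fBex B fun y => fEq z (opair x y))
    (fBall A fun x => fBex B fun y => fAnd (fMem (opair x y) f)
      (fAll fun y' => fImp (fMem (opair x y') f) (fEq y' y)))

/-- "`(Q, R)` is a forcing poset with largest element `e`": `R` is a reflexive and transitive
relation on `Q`, where `(x, y) ∈ R` is read `x ≤ y`, and `e` is a largest element of `Q`. -/
def fPoset (Q R e : PName P) : Stmt P :=
  fAnd (fBall R fun z => fBex Q fun x => fBex Q fun y => fEq z (opair x y)) <|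
  fAnd (fBall Q fun x => fMem (opair x x) R) <|
  fAnd (fBall Q fun x => fBall Q fun y => fBall Q fun z =>
    fImp (fMem (opair x y) R) (fImp (fMem (opair y z) R) (fMem (opair x z) R))) <|
  fAnd (fMem e Q) (fBall Q fun x => fMem (opair x e) R)

/-- The canonical name of the ground model relation `{(ξ, η) ∈ ω₁ × ω₁ : r_ξ ≤ r_η}`. The order of
ground model reals is absolute, so that this is also the relation computed in the extension. -/
noncomputable def leName (P : Type u) (r : Omega1.{u} → ℝ) : PName P :=
  .mk ({x : (ω₁ : Ordinal.{u}).ToType × (ω₁ : Ordinal.{u}).ToType //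
      r x.1.toOrd ≤ r x.2.toOrd} × P)
    (fun x => opair (checkOrd P x.1.1.1.toOrd) (checkOrd P x.1.1.2.toOrd))
    (fun x => x.2)

/-- "`a_0, …, a_{n-1}` are functions from `ω₁` to `ω₁` and `a_0(α) < ⋯ < a_{n-1}(α)` for all `α`".
Such an `n`-tuple of functions is the same thing as a sequence `⟨a_α : α < ω₁⟩` of elements of
`[ω₁]ⁿ`, with `a_α(i) = a_i(α)`. -/
noncomputable def fSubsetSeq {n : ℕ} (a : Fin n → PName P) : Stmt P :=
  fAnd (fAll fun i => fFun (a i) (checkOrd P ω₁) (checkOrd P ω₁))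
    (fAll fun ij : {ij : Fin n × Fin n // ij.1 < ij.2} =>
      fBall (checkOrd P ω₁) fun α => fAll fun x => fAll fun y =>
        fImp (fMem (opair α x) (a ij.1.1)) (fImp (fMem (opair α y) (a ij.1.2)) (fMem x y)))

/-- "The forcing poset `(Q, R)` is appropriate for the set of reals enumerated by `r`": for all
`n < ω` and all sequences `f = ⟨p_α : α < ω₁⟩` in `Q` and `a = ⟨a_α : α < ω₁⟩` in `[ω₁]ⁿ` there are
`α < β` such that `p_α` and `p_β` are compatible and `r_{a_α(i)} ≤ r_{a_β(i)}` for all `i < n`. -/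
noncomputable def fAppropriate (r : Omega1.{u} → ℝ) (Q R : PName P) : Stmt P :=
  fAll fun n : ℕ => fAll fun f : PName P => fAll fun a : Fin n → PName P =>
    fImp (fAnd (fFun f (checkOrd P ω₁) Q) (fSubsetSeq a)) <|
      fBex (checkOrd P ω₁) fun α => fBex (checkOrd P ω₁) fun β => fAnd (fMem α β) <|
        fAnd
          (fEx fun p => fEx fun q => fAnd (fMem (opair α p) f) <| fAnd (fMem (opair β q) f) <|
            fBex Q fun s => fAnd (fMem (opair s p) R) (fMem (opair s q) R))
          (fAll fun i : Fin n => fEx fun x => fEx fun y => fAnd (fMem (opair α x) (a i)) <|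
            fAnd (fMem (opair β y) (a i)) (fMem (opair x y) (leName P r)))

end Forcing

/-! ### Finite support iterations -/

/-- A finite support iteration `⟨P_α, Q̇_α⟩` of length `δ`: the posets `P_α` for `α ≤ δ` and the
names `Q̇_α` (with order `R_α` and largest element `one α`) for `α < δ`. The values of the data at
larger ordinals are irrelevant.

The elements of `P_α` are the sequences `p = ⟨p(β) : β < α⟩`, where `p(β)` is `coord p β`, such that
`p(β) ∈ dom Q̇_β` and `p↾β ⊩ p(β) ∈ Q̇_β` for all `β < α`, and `p(β)` is the name `one β` for all
but finitely many `β < α`. -/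
structure FSIteration (δ : Ordinal.{u}) where
  /-- the posets `P_α` -/
  P : Ordinal.{u} → Type u
  /-- the order of `P_α` -/
  [preorder : ∀ α, Preorder (P α)]
  /-- the name `Q̇_α` of the underlying set of the iterand -/
  Q : ∀ α, PName (P α)
  /-- the name of the order of the iterand -/
  R : ∀ α, PName (P α)
  /-- the name of the largest element of the iterand -/
  one : ∀ α, PName (P α)
  /-- the value `p(β)` of the sequence `p ∈ P_α` at `β < α` -/
  coord : ∀ {α : Ordinal.{u}}, P α → ∀ β, β < α → PName (P β)
  /-- the restriction `p↾β` -/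
  restr : ∀ {α β : Ordinal.{u}}, β ≤ α → P α → P β
  one_mem_dom : ∀ β < δ, one β ∈ (Q β).dom
  forces_poset : ∀ β < δ, ∀ p : P β, fPoset (Q β) (R β) (one β) p
  /-- A condition is determined by its coordinates. -/
  coord_ext : ∀ α ≤ δ, ∀ p q : P α, (∀ β (hβ : β < α), coord p β hβ = coord q β hβ) → p = q
  coord_restr : ∀ α ≤ δ, ∀ β (hβ : β ≤ α) (p : P α) ξ (hξ : ξ < β),
    coord (restr hβ p) ξ hξ = coord p ξ (hξ.trans_le hβ)
  coord_mem_dom : ∀ α ≤ δ, ∀ (p : P α) β (hβ : β < α), coord p β hβ ∈ (Q β).dom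
  restr_forces : ∀ α ≤ δ, ∀ (p : P α) β (hβ : β < α),
    fMem (coord p β hβ) (Q β) (restr hβ.le p)
  finite_support : ∀ α ≤ δ, ∀ p : P α, {β | ∃ hβ : β < α, coord p β hβ ≠ one β}.Finite
  /-- Every sequence with the above properties is a condition. -/
  exists_cond : ∀ α ≤ δ, ∀ f : (∀ β, β < α → PName (P β)),
    (∀ β (hβ : β < α), f β hβ ∈ (Q β).dom) →
    (∀ β (hβ : β < α), ∃ s : P β,
      (∀ ξ (hξ : ξ < β), coord s ξ hξ = f ξ (hξ.trans hβ)) ∧ fMem (f β hβ) (Q β) s) →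
    {β | ∃ hβ : β < α, f β hβ ≠ one β}.Finite →
    ∃ p : P α, ∀ β (hβ : β < α), coord p β hβ = f β hβ
  /-- `p ≤ q` if and only if `p↾β ⊩ p(β) ≤ q(β)` for all `β < α`. -/
  le_iff : ∀ α ≤ δ, ∀ p q : P α,
    p ≤ q ↔ ∀ β (hβ : β < α), fMem (opair (coord p β hβ) (coord q β hβ)) (R β) (restr hβ.le p)

attribute [instance] FSIteration.preorder

end FSI

/-! The proof is by induction on the stage of the iteration. At stage 0 the poset has a single
condition, so appropriateness is exactly goodness of the enumeration.

At a successor, only the countable chain condition of `P β` is needed, which is the case `n = 0` of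
the inductive hypothesis. Given `(p α, q α)` and `a α`, the chain condition yields a condition
forcing uncountably many `p α` into the generic filter. A name for an increasing enumeration of such
indices (`HasCCC.exists_selector`) turns `q` and `a` into names for `ω₁`-sequences, to which the
forced appropriateness of the iterand applies. Deciding the two indices it provides gives the
required pair in the ground model (`HasCCC.exists_forces_compat`), because the order of ground model
reals is absolute.

At a limit, whatever its cofinality, the finite supports are thinned out until all pairwise
intersections lie in one finite set, hence below some `γ < α`. Appropriateness of `P γ` gives two
conditions with compatible restrictions, and disjointness of the supports above `γ` lets a common
extension be glued (`FSIteration.compat_of_restr`). -/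

namespace FSI

/-! ### Forced equality and membership -/

section ForcingLemmas

variable {P : Type u}

def PName.Index : PName P → Type u
  | .mk ι _ _ => ι

def PName.val : (σ : PName P) → σ.Index → PName P
  | .mk _ v _ => v

def PName.cond : (σ : PName P) → σ.Index → P
  | .mk _ _ c => c

theorem PName.mem_dom_iff {σ τ : PName P} : σ ∈ τ.dom ↔ ∃ i, τ.val i = σ := by
  cases τ; exact Iff.rfl

variable [Preorder P]

theorem fEq_iff {σ τ : PName P} {p : P} : fEq σ τ p ↔
    (∀ i, ∀ q ≤ p, q ≤ σ.cond i → ∃ s ≤ q, ∃ j, s ≤ τ.cond j ∧ fEq (σ.val i) (τ.val j) s) ∧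
    (∀ j, ∀ q ≤ p, q ≤ τ.cond j → ∃ s ≤ q, ∃ i, s ≤ σ.cond i ∧ fEq (σ.val i) (τ.val j) s) := by
  cases σ; cases τ; exact Iff.rfl

theorem fMem_iff {σ τ : PName P} {p : P} : fMem σ τ p ↔
    ∀ q ≤ p, ∃ s ≤ q, ∃ j, s ≤ τ.cond j ∧ fEq σ (τ.val j) s := by
  cases τ; exact Iff.rfl

theorem fEq.mono {σ τ : PName P} {p q : P} (h : fEq σ τ p) (hq : q ≤ p) : fEq σ τ q := by
  rw [fEq_iff] at h ⊢
  exact ⟨fun i s hs => h.1 i s (hs.trans hq), fun i s hs => h.2 i s (hs.trans hq)⟩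

theorem fMem.mono {σ τ : PName P} {p q : P} (h : fMem σ τ p) (hq : q ≤ p) : fMem σ τ q := by
  rw [fMem_iff] at h ⊢
  exact fun s hs => h s (hs.trans hq)

/-- Each clause in the recursion for forced equality only asks for a further extension, so density
is absorbed. This allows equalities to be proved after strengthening the condition to decide values.
-/
theorem fEq_of_dense {σ τ : PName P} {p : P} (h : ∀ q ≤ p, ∃ s ≤ q, fEq σ τ s) :
    fEq σ τ p := by
  rw [fEq_iff]
  constructor
  · intro i q hq hqi
    obtain ⟨s, hs, h'⟩ := h q hq
    obtain ⟨t, ht, j, h1, h2⟩ := (fEq_iff.1 h').1 i s le_rfl (hs.trans hqi)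
    exact ⟨t, ht.trans hs, j, h1, h2⟩
  · intro i q hq hqi
    obtain ⟨s, hs, h'⟩ := h q hq
    obtain ⟨t, ht, j, h1, h2⟩ := (fEq_iff.1 h').2 i s le_rfl (hs.trans hqi)
    exact ⟨t, ht.trans hs, j, h1, h2⟩

theorem fMem_of_dense {σ τ : PName P} {p : P} (h : ∀ q ≤ p, ∃ s ≤ q, fMem σ τ s) :
    fMem σ τ p := by
  rw [fMem_iff]
  intro q hq
  obtain ⟨s, hs, h'⟩ := h q hq
  obtain ⟨t, ht, j, h1, h2⟩ := fMem_iff.1 h' s le_rfl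
  exact ⟨t, ht.trans hs, j, h1, h2⟩

theorem fMem.exists_fEq {σ τ : PName P} {p : P} (h : fMem σ τ p) :
    ∃ s ≤ p, ∃ j, s ≤ τ.cond j ∧ fEq σ (τ.val j) s :=
  fMem_iff.1 h p le_rfl

theorem fEq.refl (σ : PName P) (p : P) : fEq σ σ p := by
  induction σ generalizing p with
  | mk ι v c ih =>
    exact ⟨fun i q _ hqi => ⟨q, le_rfl, i, hqi, ih i q⟩,
      fun i q _ hqi => ⟨q, le_rfl, i, hqi, ih i q⟩⟩

theorem fEq.symm {σ τ : PName P} {p : P} (h : fEq σ τ p) : fEq τ σ p := by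
  induction σ generalizing τ p with
  | mk ι v c ih =>
    cases τ with
    | mk κ w d =>
      refine ⟨fun j q hq hqj => ?_, fun i q hq hqi => ?_⟩
      · obtain ⟨s, hs, i, h1, h2⟩ := h.2 j q hq hqj
        exact ⟨s, hs, i, h1, ih i h2⟩
      · obtain ⟨s, hs, j, h1, h2⟩ := h.1 i q hq hqi
        exact ⟨s, hs, j, h1, ih i h2⟩

theorem fEq.trans {σ τ π : PName P} {p : P} (h : fEq σ τ p) (h' : fEq τ π p) : fEq σ π p := by
  induction σ generalizing τ π p with
  | mk ι v c ih =>
    cases τ with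
    | mk κ w d =>
      cases π with
      | mk μ x e =>
        refine ⟨fun i q hq hqi => ?_, fun k q hq hqk => ?_⟩
        · obtain ⟨s, hs, j, h1, h2⟩ := h.1 i q hq hqi
          obtain ⟨t, ht, k, h3, h4⟩ := h'.1 j s (hs.trans hq) h1
          exact ⟨t, ht.trans hs, k, h3, ih i (h2.mono ht) h4⟩
        · obtain ⟨s, hs, j, h1, h2⟩ := h'.2 k q hq hqk
          obtain ⟨t, ht, i, h3, h4⟩ := h.2 j s (hs.trans hq) h1
          exact ⟨t, ht.trans hs, i, h3, ih i h4 (h2.mono ht)⟩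

theorem fMem.congr_left {σ σ' τ : PName P} {p : P} (h : fMem σ τ p) (e : fEq σ σ' p) :
    fMem σ' τ p := by
  rw [fMem_iff] at h ⊢
  intro q hq
  obtain ⟨s, hs, j, h1, h2⟩ := h q hq
  exact ⟨s, hs, j, h1, (e.mono (hs.trans hq)).symm.trans h2⟩

theorem fMem.congr_right {σ τ τ' : PName P} {p : P} (h : fMem σ τ p) (e : fEq τ τ' p) :
    fMem σ τ' p := by
  rw [fMem_iff] at h ⊢
  intro q hq
  obtain ⟨s, hs, j, h1, h2⟩ := h q hq
  obtain ⟨t, ht, k, h3, h4⟩ := (fEq_iff.1 e).1 j s (hs.trans hq) h1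
  exact ⟨t, ht.trans hs, k, h3, (h2.mono ht).trans h4⟩

theorem fMem_of_le_cond {τ : PName P} {p : P} (j : τ.Index) (h : p ≤ τ.cond j) :
    fMem (τ.val j) τ p :=
  fMem_iff.2 fun q hq => ⟨q, le_rfl, j, hq.trans h, fEq.refl _ _⟩

/-! ### Unordered and ordered pairs -/

theorem fMem_upair_iff {x σ τ : PName P} {p : P} :
    fMem x (upair σ τ) p ↔ ∀ q ≤ p, ∃ s ≤ q, fEq x σ s ∨ fEq x τ s := by
  constructor
  · intro h q hq
    obtain ⟨s, hs, ⟨⟨b⟩, c⟩, -, h2⟩ := h q hq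
    refine ⟨s, hs, ?_⟩
    cases b
    · exact Or.inr h2
    · exact Or.inl h2
  · intro h q hq
    obtain ⟨s, hs, h1 | h1⟩ := h q hq
    · exact ⟨s, hs, ⟨⟨true⟩, s⟩, le_rfl, h1⟩
    · exact ⟨s, hs, ⟨⟨false⟩, s⟩, le_rfl, h1⟩

theorem fMem_upair_left (σ τ : PName P) (p : P) : fMem σ (upair σ τ) p :=
  fMem_upair_iff.2 fun q _ => ⟨q, le_rfl, Or.inl (fEq.refl _ _)⟩

theorem fMem_upair_right (σ τ : PName P) (p : P) : fMem τ (upair σ τ) p :=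
  fMem_upair_iff.2 fun q _ => ⟨q, le_rfl, Or.inr (fEq.refl _ _)⟩

theorem fMem.fEq_of_singleton {x σ : PName P} {p : P} (h : fMem x (upair σ σ) p) :
    fEq x σ p :=
  fEq_of_dense fun q hq => by simpa using fMem_upair_iff.1 h q hq

theorem fEq_upair {σ σ' τ τ' : PName P} {p : P} (h : fEq σ σ' p) (h' : fEq τ τ' p) :
    fEq (upair σ τ) (upair σ' τ') p := by
  constructor
  · rintro ⟨⟨b⟩, c⟩ q hq hqc
    refine ⟨q, le_rfl, ⟨⟨b⟩, q⟩, le_rfl, ?_⟩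
    cases b
    · exact h'.mono hq
    · exact h.mono hq
  · rintro ⟨⟨b⟩, c⟩ q hq hqc
    refine ⟨q, le_rfl, ⟨⟨b⟩, q⟩, le_rfl, ?_⟩
    cases b
    · exact h'.mono hq
    · exact h.mono hq

theorem fEq_opair {σ σ' τ τ' : PName P} {p : P} (h : fEq σ σ' p) (h' : fEq τ τ' p) :
    fEq (opair σ τ) (opair σ' τ') p :=
  fEq_upair (fEq_upair h h) (fEq_upair h h')

theorem fEq.opair_left {a b c d : PName P} {p : P} (h : fEq (opair a b) (opair c d) p) :
    fEq a c p := by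
  have h1 : fMem (upair a a) (opair c d) p := (fMem_upair_left _ _ _).congr_right h
  refine fEq_of_dense fun q hq => ?_
  obtain ⟨s, hs, h2 | h2⟩ := fMem_upair_iff.1 h1 q hq
  · exact ⟨s, hs, ((fMem_upair_left _ _ _).congr_right h2).fEq_of_singleton⟩
  · exact ⟨s, hs, ((fMem_upair_left _ _ _).congr_right h2.symm).fEq_of_singleton.symm⟩

theorem fEq.mem_upair_of_opair {a b c d : PName P} {p : P}
    (h : fEq (opair a b) (opair c d) p) : fMem b (upair c d) p := by
  have h1 : fMem (upair a b) (opair c d) p := (fMem_upair_right _ _ _).congr_right h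
  refine fMem_of_dense fun q hq => ?_
  obtain ⟨s, hs, h2 | h2⟩ := fMem_upair_iff.1 h1 q hq
  · exact ⟨s, hs, (fMem_upair_left c d s).congr_left
      ((fMem_upair_right a b s).congr_right h2).fEq_of_singleton.symm⟩
  · exact ⟨s, hs, (fMem_upair_right _ _ _).congr_right h2⟩

/-- The inclusion `b ∈ {c, d}` leaves only the case `b = c`. There the symmetric inclusion `d ∈ {a,
b}` suffices, since `a = c` makes `a`, `b` and `c` coincide. -/
theorem fEq.opair_right {a b c d : PName P} {p : P} (h : fEq (opair a b) (opair c d) p) :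
    fEq b d p := by
  refine fEq_of_dense fun q hq => ?_
  obtain ⟨s, hs, h2 | h2⟩ := fMem_upair_iff.1 h.mem_upair_of_opair q hq
  · have hsp := hs.trans hq
    obtain ⟨t, ht, h3 | h3⟩ := fMem_upair_iff.1 (h.symm.mono hsp).mem_upair_of_opair s le_rfl
    · exact ⟨t, ht.trans hs,
        ((h2.mono ht).trans (h.opair_left.mono (ht.trans hsp)).symm).trans h3.symm⟩
    · exact ⟨t, ht.trans hs, h3.symm⟩
  · exact ⟨s, hs, h2⟩

/-! ### Canonical names -/

theorem fMem_check_iff {σ : PName P} {x : PSet.{u}} {p : P} :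
    fMem σ (check P x) p ↔ ∀ q ≤ p, ∃ s ≤ q, ∃ i, fEq σ (check P (x.Func i)) s := by
  cases x with
  | mk ι v =>
    constructor
    · intro h q hq
      obtain ⟨s, hs, ⟨i, c⟩, -, h2⟩ := h q hq
      exact ⟨s, hs, i, h2⟩
    · intro h q hq
      obtain ⟨s, hs, i, h2⟩ := h q hq
      exact ⟨s, hs, ⟨i, s⟩, le_rfl, h2⟩

theorem fEq_check {x y : PSet.{u}} (h : x.Equiv y) (p : P) : fEq (check P x) (check P y) p := by
  induction x generalizing y p with
  | mk ι v ih =>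
    cases y with
    | mk κ w =>
      constructor
      · rintro ⟨i, c⟩ q hq hqc
        obtain ⟨j, hj⟩ := h.1 i
        exact ⟨q, le_rfl, ⟨j, q⟩, le_rfl, ih i hj q⟩
      · rintro ⟨j, c⟩ q hq hqc
        obtain ⟨i, hi⟩ := h.2 j
        exact ⟨q, le_rfl, ⟨i, q⟩, le_rfl, ih i hi q⟩

/-- Every element of a canonical name is paired with every condition, so `p` itself can be used to
test each index, and induction on the set applies. -/
theorem equiv_of_fEq_check {x y : PSet.{u}} {p : P} (h : fEq (check P x) (check P y) p) :
    x.Equiv y := by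
  induction x generalizing y p with
  | mk ι v ih =>
    cases y with
    | mk κ w =>
      constructor
      · intro i
        obtain ⟨s, -, ⟨j, c⟩, -, h2⟩ := h.1 ⟨i, p⟩ p le_rfl le_rfl
        exact ⟨j, ih i h2⟩
      · intro j
        obtain ⟨s, -, ⟨i, c⟩, -, h2⟩ := h.2 ⟨j, p⟩ p le_rfl le_rfl
        exact ⟨i, ih i h2⟩

theorem eq_of_fEq_checkOrd {ξ η : Ordinal.{u}} {p : P}
    (h : fEq (checkOrd P ξ) (checkOrd P η) p) : ξ = η := by
  simpa using PSet.rank_congr (equiv_of_fEq_check h)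

theorem fMem_checkOrd_iff {σ : PName P} {o : Ordinal.{u}} {p : P} :
    fMem σ (checkOrd P o) p ↔ ∀ q ≤ p, ∃ s ≤ q, ∃ ξ < o, fEq σ (checkOrd P ξ) s := by
  rw [checkOrd, fMem_check_iff]
  constructor
  · intro h q hq
    obtain ⟨s, hs, i, h1⟩ := h q hq
    obtain ⟨ξ, hξ, h2⟩ := Ordinal.mem_toPSet_iff.1 (PSet.func_mem _ i)
    exact ⟨s, hs, ξ, hξ, h1.trans (fEq_check h2 s)⟩
  · intro h q hq
    obtain ⟨s, hs, ξ, hξ, h1⟩ := h q hq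
    obtain ⟨i, hi⟩ := PSet.mem_def.1 (Ordinal.mem_toPSet_iff.2 ⟨ξ, hξ, PSet.Equiv.refl _⟩)
    exact ⟨s, hs, i, h1.trans (fEq_check hi s)⟩

theorem fMem_checkOrd_of_lt {ξ o : Ordinal.{u}} (h : ξ < o) (p : P) :
    fMem (checkOrd P ξ) (checkOrd P o) p :=
  fMem_checkOrd_iff.2 fun q _ => ⟨q, le_rfl, ξ, h, fEq.refl _ _⟩

theorem lt_of_fMem_checkOrd {ξ o : Ordinal.{u}} {p : P}
    (h : fMem (checkOrd P ξ) (checkOrd P o) p) : ξ < o := by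
  obtain ⟨s, -, η, hη, h1⟩ := fMem_checkOrd_iff.1 h p le_rfl
  exact eq_of_fEq_checkOrd h1 ▸ hη

end ForcingLemmas

/-! ### Countable ordinals -/

theorem countable_Iio_omega1 (η : Omega1.{u}) : Countable (Set.Iio η) := by
  have h : (η.1).card ≤ ℵ₀ := by
    have h0 : η.1 < ω₁ := η.2
    generalize η.1 = o at h0
    rwa [← Cardinal.ord_aleph, Cardinal.lt_ord, ← zero_add (1 : Ordinal), ← Cardinal.succ_aleph,
      Cardinal.aleph_zero, Order.lt_succ_iff] at h0
  have h1 : Countable (Set.Iio η.1) := by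
    rwa [← Cardinal.mk_le_aleph0_iff, Cardinal.mk_Iio_ordinal, Cardinal.lift_le_aleph0]
  exact Function.Injective.countable (f := fun x : Set.Iio η => (⟨x.1.1, x.2⟩ : Set.Iio η.1))
    fun x y h => by simpa [Subtype.ext_iff] using h

theorem exists_lt_omega1 {ι : Type*} [Countable ι] (f : ι → Omega1.{u}) : ∃ b, ∀ i, f i < b := by
  have h1 : ∀ i, Order.succ (f i).1 < ω₁ := fun i =>
    (Cardinal.isSuccLimit_omega 1).succ_lt (f i).2
  refine ⟨⟨⨆ i, Order.succ (f i).1, Ordinal.iSup_lt_omega_one h1⟩, fun i => ?_⟩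
  have h2 : BddAbove (Set.range fun i => Order.succ (f i).1) :=
    ⟨ω₁, by rintro _ ⟨i, rfl⟩; exact (h1 i).le⟩
  exact (Order.lt_succ (f i).1).trans_le (le_ciSup h2 i)

/-- Thinning out: an unbounded set of countable ordinals has an increasing enumeration that
grows faster than `g`. -/
theorem exists_strictMono_omega1 {S : Omega1.{u} → Prop} (hS : ∀ ξ, ∃ η, ξ < η ∧ S η)
    (g : Omega1.{u} → Omega1.{u}) :
    ∃ e : Omega1.{u} → Omega1.{u}, StrictMono e ∧ (∀ ξ, S (e ξ)) ∧
      ∀ ζ η, ζ < η → g (e ζ) < e η := by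
  have key : ∀ (η : Omega1.{u}) (F : ∀ ζ, ζ < η → Omega1.{u}),
      ∃ b, S b ∧ ∀ ζ (h : ζ < η), F ζ h < b ∧ g (F ζ h) < b := by
    intro η F
    have := countable_Iio_omega1 η
    obtain ⟨b1, h1⟩ := exists_lt_omega1 fun ζ : Set.Iio η => max (F ζ.1 ζ.2) (g (F ζ.1 ζ.2))
    obtain ⟨b, h2, h3⟩ := hS b1
    exact ⟨b, h3, fun ζ h => by simpa using (h1 ⟨ζ, h⟩).trans h2⟩
  choose next hnext using key
  let e : Omega1.{u} → Omega1.{u} := WellFoundedLT.fix fun η F => next η F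
  have he : ∀ η, e η = next η fun ζ _ => e ζ := fun η => WellFoundedLT.fix_eq _ η
  refine ⟨e, fun ζ η h => ?_, fun η => ?_, fun ζ η h => ?_⟩
  · rw [he η]; exact ((hnext η _).2 ζ h).1
  · rw [he η]; exact (hnext η _).1
  · rw [he η]; exact ((hnext η _).2 ζ h).2

theorem exists_gt_omega1 (ξ : Omega1.{u}) : ∃ η, ξ < η := by
  simpa using exists_lt_omega1 fun _ : Unit => ξ

/-- If every size bound held only for boundedly many indices, an index above these countably many
bounds would violate the bound given by its own cardinality. -/
theorem exists_strictMono_le_card {X : Type*} (F : Omega1.{u} → Finset X) :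
    ∃ (n : ℕ) (e : Omega1.{u} → Omega1.{u}), StrictMono e ∧ ∀ ξ, (F (e ξ)).card ≤ n := by
  have : ∃ n : ℕ, ∀ ξ, ∃ η, ξ < η ∧ (F η).card ≤ n := by
    by_contra! h
    choose b hb using h
    obtain ⟨c, hc⟩ := exists_lt_omega1 b
    exact (hb _ c (hc _)).ne rfl
  obtain ⟨n, hn⟩ := this
  obtain ⟨e, h1, h2, -⟩ := exists_strictMono_omega1 hn id
  exact ⟨n, e, h1, h2⟩

/-- A weak form of the `Δ`-system lemma. -/
theorem exists_strictMono_inter_subset {X : Type*} [DecidableEq X] (F : Omega1.{u} → Finset X) :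
    ∃ (e : Omega1.{u} → Omega1.{u}) (K : Finset X), StrictMono e ∧
      ∀ ξ η, ξ < η → F (e ξ) ∩ F (e η) ⊆ K := by
  obtain ⟨n, e, he, hn⟩ := exists_strictMono_le_card F
  suffices H : ∀ (n : ℕ) (F : Omega1.{u} → Finset X), (∀ ξ, (F ξ).card ≤ n) →
      ∃ (e : Omega1.{u} → Omega1.{u}) (K : Finset X), StrictMono e ∧
        ∀ ξ η, ξ < η → F (e ξ) ∩ F (e η) ⊆ K by
    obtain ⟨e', K, h1, h2⟩ := H n (F ∘ e) hn
    exact ⟨e ∘ e', K, he.comp h1, h2⟩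
  clear! F
  intro n
  induction n with
  | zero =>
    intro F hF
    refine ⟨id, ∅, strictMono_id, fun ξ η _ => ?_⟩
    have : F ξ = ∅ := by simpa using hF ξ
    simp [this]
  | succ n ih =>
    intro F hF
    -- Either some `x` lies in unboundedly many of the sets, and can be removed and put into the
    -- root, or every `x` occurs only boundedly often, and the sets can be made pairwise disjoint.
    by_cases h : ∃ x, ∀ ξ, ∃ η, ξ < η ∧ x ∈ F η
    · obtain ⟨x, hx⟩ := h
      obtain ⟨e, he, hxe, -⟩ := exists_strictMono_omega1 hx id
      obtain ⟨e', K, he', hK⟩ := ih (fun ξ => (F (e ξ)).erase x) fun ξ => by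
        rw [Finset.card_erase_of_mem (hxe ξ)]
        exact Nat.sub_le_of_le_add (hF _)
      refine ⟨e ∘ e', insert x K, he.comp he', fun ξ η hξ y hy => ?_⟩
      have := @hK ξ η hξ y
      simp only [Function.comp, Finset.mem_inter, Finset.mem_erase, Finset.mem_insert] at *
      tauto
    · push Not at h
      choose b hb using h
      have hg : ∀ ξ, ∃ c, ∀ x ∈ F ξ, b x < c := fun ξ => by
        obtain ⟨c, hc⟩ := exists_lt_omega1 fun x : F ξ => b x.1
        exact ⟨c, fun x hx => hc ⟨x, hx⟩⟩
      choose g hg using hg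
      obtain ⟨e, he, -, hge⟩ := exists_strictMono_omega1 (S := fun _ => True)
        (fun ξ => by simpa using exists_gt_omega1 ξ) g
      refine ⟨e, ∅, he, fun ξ η hξ y hy => ?_⟩
      rw [Finset.mem_inter] at hy
      exact absurd hy.2 (hb y _ ((hg _ y hy.1).trans (hge ξ η hξ)))

/-! ### Consequences of the countable chain condition -/

section CCC

variable {P : Type u} [Preorder P]

/-- A form of the countable chain condition. -/
def HasCCC (P : Type u) [Preorder P] : Prop :=
  ∀ p : Omega1.{u} → P, ∃ α β, α < β ∧ Compat (p α) (p β)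

theorem Appropriate.hasCCC {r : Omega1.{u} → ℝ} (h : Appropriate r P) : HasCCC P := fun p => by
  obtain ⟨α, β, h1, h2, -⟩ := h 0 p fun _ => ⟨∅, rfl⟩
  exact ⟨α, β, h1, h2⟩

theorem Compat.symm {p q : P} (h : Compat p q) : Compat q p :=
  let ⟨s, h1, h2⟩ := h; ⟨s, h2, h1⟩

theorem Compat.of_le_left {p p' q : P} (h : Compat p q) (hp : p ≤ p') : Compat p' q :=
  let ⟨s, h1, h2⟩ := h; ⟨s, h1.trans hp, h2⟩

theorem Compat.of_le_right {p q q' : P} (h : Compat p q) (hq : q ≤ q') : Compat p q' :=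
  let ⟨s, h1, h2⟩ := h; ⟨s, h1, h2.trans hq⟩

/-- Some condition forces that uncountably many `p α` belong to the generic filter. -/
theorem HasCCC.exists_forces_unbounded (hP : HasCCC P) (p : Omega1.{u} → P) :
    ∃ p₀ : P, ∀ ξ, ∀ s ≤ p₀, ∃ α, ξ ≤ α ∧ Compat s (p α) := by
  by_contra! h
  -- Each `p α` has an extension `s α` incompatible with all `p β` for `β` from `ξ α` on. Spacing
  -- indices by `ξ` makes these extensions an uncountable antichain.
  choose ξ s hs hξ using fun α => h (p α)
  obtain ⟨e, -, -, he⟩ := exists_strictMono_omega1 (S := fun _ => True)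
    (fun ξ => by simpa using exists_gt_omega1 ξ) ξ
  obtain ⟨ζ, η, h1, h2⟩ := hP fun η => s (e η)
  exact hξ _ _ (he ζ η h1).le (h2.of_le_right (hs _))

/-- This is how the chain condition keeps `ω₁` regular in the extension: the next index in the
generic filter is bounded in the ground model. Otherwise, witnesses `t η ≤ p (α η)` avoiding all `p
β` with `ξ ≤ β < η` would thin out to an uncountable antichain. -/
theorem HasCCC.exists_predense_interval (hP : HasCCC P) {p : Omega1.{u} → P} {p₀ : P}
    {ξ : Omega1.{u}} (h : ∀ s ≤ p₀, ∃ α, ξ ≤ α ∧ Compat s (p α)) :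
    ∃ η, ∀ s ≤ p₀, ∃ α, ξ ≤ α ∧ α < η ∧ Compat s (p α) := by
  by_contra! h'
  choose s hs hη using h'
  choose α hα t hts htp using fun η => h (s η) (hs η)
  obtain ⟨e, -, -, he⟩ := exists_strictMono_omega1 (S := fun _ => True)
    (fun ξ => by simpa using exists_gt_omega1 ξ) α
  obtain ⟨ζ, η, h1, h2⟩ := hP fun η => t (e η)
  exact hη (e η) (α (e ζ)) (hα _) (he ζ η h1) ((h2.symm.of_le_left (hts _)).of_le_right (htp _))

/-- `S ξ α c` says that `c` decides the value at `ξ` of a function from `ω₁` to `ω₁` to be `α`;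
this function is total below `p₀`. -/
structure Selector (p₀ : P) (S : Omega1.{u} → Omega1.{u} → P → Prop) : Prop where
  mono : ∀ ξ α c d, S ξ α c → d ≤ c → S ξ α d
  unique : ∀ ξ α β c, S ξ α c → S ξ β c → α = β
  dense : ∀ ξ, ∀ s ≤ p₀, ∃ t ≤ s, ∃ α, S ξ α t

/-- There is a name for a strictly increasing function that lists indices `α` such that `p α`
belongs to the generic filter. -/
theorem HasCCC.exists_selector (hP : HasCCC P) (p : Omega1.{u} → P) :
    ∃ (p₀ : P) (S : Omega1.{u} → Omega1.{u} → P → Prop), Selector p₀ S ∧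
      (∀ ξ α c, S ξ α c → c ≤ p α) ∧
      ∀ ξ η α β c d, S ξ α c → S η β d → ξ < η → α < β := by
  obtain ⟨p₀, hp₀⟩ := hP.exists_forces_unbounded p
  choose g hg using fun ξ => hP.exists_predense_interval (hp₀ ξ)
  obtain ⟨e, -, -, he⟩ := exists_strictMono_omega1 (S := fun _ => True)
    (fun ξ => by simpa using exists_gt_omega1 ξ) g
  -- The value at `ξ` is the least index in the block `[e ξ, g (e ξ))` whose condition is in the
  -- generic filter: `c` lies below `p α` and is incompatible with the earlier conditions of the
  -- block. Successive blocks are disjoint, so the values increase.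
  refine ⟨p₀, fun ξ α c => e ξ ≤ α ∧ α < g (e ξ) ∧ c ≤ p α ∧
    ∀ β < α, e ξ ≤ β → ¬ Compat c (p β), ⟨?_, ?_, ?_⟩, ?_, ?_⟩
  · rintro ξ α c d ⟨h1, h2, h3, h4⟩ hd
    exact ⟨h1, h2, hd.trans h3, fun β hβ hξ h => h4 β hβ hξ (h.of_le_left hd)⟩
  · rintro ξ α β c ⟨h1, h2, h3, h4⟩ ⟨h1', h2', h3', h4'⟩
    rcases lt_trichotomy α β with h | h | h
    · exact absurd ⟨c, le_rfl, h3⟩ (h4' α h h1)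
    · exact h
    · exact absurd ⟨c, le_rfl, h3'⟩ (h4 β h h1')
  · intro ξ s hs
    obtain ⟨α, ⟨h1, h2, h3⟩, hmin⟩ := WellFounded.has_min (wellFounded_lt (α := Omega1.{u}))
      {α | e ξ ≤ α ∧ α < g (e ξ) ∧ Compat s (p α)} (hg (e ξ) s hs)
    obtain ⟨t, hts, htp⟩ := h3
    exact ⟨t, hts, α, h1, h2, htp, fun β hβ hξ h =>
      hmin β ⟨hξ, hβ.trans h2, h.of_le_left hts⟩ hβ⟩
  · rintro ξ α c ⟨-, -, h, -⟩
    exact h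
  · rintro ξ η α β c d ⟨-, h1, -⟩ ⟨h2, -⟩ h
    exact (h1.trans (he ξ η h)).trans_le h2

end CCC

/-! ### Names for generic subsequences and the two-step iteration -/

section SeqNames

variable {P : Type u} [Preorder P]

/-- The name of the function that maps `ξ < ω₁` to `v α`, where `α` is the value at `ξ` of the
function described by `S`. -/
noncomputable def seqName (S : Omega1.{u} → Omega1.{u} → P → Prop) (v : Omega1.{u} → PName P) :
    PName P :=
  -- The indices come from `ToType` rather than `Omega1`, which lives one universe too high to index
  -- a name.
  .mk {x : (ω₁ : Ordinal.{u}).ToType × (ω₁ : Ordinal.{u}).ToType × P //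
      S x.1.toOrd x.2.1.toOrd x.2.2}
    (fun x => opair (checkOrd P x.1.1.toOrd) (v x.1.2.1.toOrd)) (fun x => x.1.2.2)

namespace Selector

variable {p₀ : P} {S : Omega1.{u} → Omega1.{u} → P → Prop}
  {v : Omega1.{u} → PName P}

theorem exists_of_fMem (hS : Selector p₀ S) {σ τ : PName P} {p : P} (h : fMem (opair σ τ) (seqName S v) p) :
    ∃ s ≤ p, ∃ ξ α, S ξ α s ∧ fEq σ (checkOrd P ξ) s ∧ fEq τ (v α) s := by
  obtain ⟨s, hs, ⟨x, hx⟩, h1, h2⟩ := h p le_rfl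
  exact ⟨s, hs, _, _, hS.mono _ _ _ _ hx h1, h2.opair_left, h2.opair_right⟩

theorem fMem_seqName {ξ α : Omega1.{u}} {p : P} (h : S ξ α p) :
    fMem (opair (checkOrd P ξ) (v α)) (seqName S v) p := by
  have key := fMem_of_le_cond (τ := seqName S v) (p := p)
    (⟨(Ordinal.ToType.mk ξ, Ordinal.ToType.mk α, p), by simpa using h⟩ : Subtype _) le_rfl
  simpa [seqName, PName.val] using key

/-- Single-valuedness of the named function: distinct ordinals have canonical names that no
condition forces equal, and the selector has at most one value at each argument. -/
theorem exists_of_fMem_of_eq (hS : Selector p₀ S) {σ τ : PName P} {p : P} {ξ α : Omega1.{u}}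
    (h : fMem (opair σ τ) (seqName S v) p) (hσ : fEq σ (checkOrd P ξ) p) (hα : S ξ α p) :
    fEq τ (v α) p := by
  refine fEq_of_dense fun q hq => ?_
  obtain ⟨s, hs, η, β, h1, h2, h3⟩ := hS.exists_of_fMem (h.mono hq)
  have hξ : ξ = η := Subtype.ext (eq_of_fEq_checkOrd ((hσ.mono (hs.trans hq)).symm.trans h2))
  subst hξ
  obtain rfl := hS.unique _ _ _ _ h1 (hS.mono _ _ _ _ hα (hs.trans hq))
  exact ⟨s, hs, h3⟩

theorem fFun_seqName (hS : Selector p₀ S) {B : PName P} (hv : ∀ ξ α c, S ξ α c → fMem (v α) B c) :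
    fFun (seqName S v) (checkOrd P ω₁) B p₀ := by
  constructor
  · intro z q hq hz q' hq'
    obtain ⟨s, hs, ⟨x, hx⟩, h1, h2⟩ := hz q' hq'
    refine ⟨s, hs, _, fMem_checkOrd_of_lt x.1.toOrd.2 s, fun t ht => ⟨t, le_rfl, _,
      (hv _ _ _ hx).mono (ht.trans h1), h2.mono ht⟩⟩
  · intro x q hq hx q' hq'
    obtain ⟨s, hs, ξ, hξ, h1⟩ := fMem_checkOrd_iff.1 hx q' hq'
    obtain ⟨t, ht, α, h2⟩ := hS.dense ⟨ξ, hξ⟩ s (hs.trans (hq'.trans hq))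
    refine ⟨t, ht.trans hs, v α, hv _ _ _ h2, ?_, ?_⟩
    · exact (fMem_seqName h2).congr_left (fEq_opair (h1.mono ht).symm (fEq.refl _ _))
    · intro y' c hc h3
      exact hS.exists_of_fMem_of_eq h3 (h1.mono (hc.trans ht)) (hS.mono _ _ _ _ h2 hc)

theorem fSubsetSeq_seqName (hS : Selector p₀ S) {n : ℕ} (a : Omega1.{u} → Omega1Sub.{u} n) :
    fSubsetSeq (fun i => seqName S fun α => checkOrd P (nthElt (a α) i)) p₀ := by
  constructor
  · intro i
    exact hS.fFun_seqName fun ξ α c _ => fMem_checkOrd_of_lt (nthElt (a α) i).2 c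
  · rintro ⟨⟨i, j⟩, hij⟩ x q hq hx y z q₁ hq₁ hy q₂ hq₂ hz
    refine fMem_of_dense fun q₃ hq₃ => ?_
    obtain ⟨s, hs, ξ, α, h1, h2, h3⟩ := hS.exists_of_fMem (hy.mono (hq₃.trans hq₂))
    have h4 := hS.exists_of_fMem_of_eq (hz.mono (hs.trans hq₃)) h2 h1
    refine ⟨s, hs, ?_⟩
    have h5 : nthElt (a α) i < nthElt (a α) j := ((a α).1.orderEmbOfFin (a α).2).strictMono hij
    exact ((fMem_checkOrd_of_lt h5 s).congr_left h3.symm).congr_right h4.symm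

end Selector

theorem le_of_fMem_leName {r : Omega1.{u} → ℝ} {ξ η : Omega1.{u}} {p : P}
    (h : fMem (opair (checkOrd P ξ) (checkOrd P η)) (leName P r) p) : r ξ ≤ r η := by
  obtain ⟨s, -, ⟨⟨x, hx⟩, c⟩, -, h2⟩ := h p le_rfl
  have h3 : ξ = x.1.toOrd := Subtype.ext (eq_of_fEq_checkOrd h2.opair_left)
  have h4 : η = x.2.toOrd := Subtype.ext (eq_of_fEq_checkOrd h2.opair_right)
  rwa [h3, h4]

/-- The heart of the successor step, for a two step iteration `P * Q̇`. -/
theorem HasCCC.exists_forces_compat (hP : HasCCC P) {r : Omega1.{u} → ℝ} {Q R : PName P}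
    (hQ : ∀ p, fAppropriate r Q R p) (p : Omega1.{u} → P) (q : Omega1.{u} → PName P)
    (hq : ∀ α, fMem (q α) Q (p α)) {n : ℕ} (a : Omega1.{u} → Omega1Sub.{u} n) :
    ∃ α β, α < β ∧
      (∃ s t, s ≤ p α ∧ s ≤ p β ∧ t ∈ Q.dom ∧ fMem t Q s ∧
        fMem (opair t (q α)) R s ∧ fMem (opair t (q β)) R s) ∧
      ∀ i, r (nthElt (a α) i) ≤ r (nthElt (a β) i) := by
  obtain ⟨p₀, S, hS, hSp, hlt⟩ := hP.exists_selector p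
  -- The same selector reindexes both sequences, so the two positions found in the extension refer
  -- to the same pair of original indices `α` and `β`.
  obtain ⟨s₁, hs₁, x, -, h₁⟩ := hQ p₀ n (seqName S q)
    (fun i => seqName S fun α => checkOrd P (nthElt (a α) i)) p₀ le_rfl
    ⟨hS.fFun_seqName fun ξ α c h => (hq α).mono (hSp _ _ _ h), hS.fSubsetSeq_seqName a⟩ p₀ le_rfl
  obtain ⟨s₂, hs₂, y, -, hxy, hcomp, hle⟩ := h₁ s₁ le_rfl
  obtain ⟨s₃, hs₃, u, s₄, hs₄, w, hu, hw, ht⟩ : ∃ s ≤ s₂, ∃ u, ∃ s' ≤ s, ∃ w,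
      fMem (opair x u) (seqName S q) s' ∧ fMem (opair y w) (seqName S q) s' ∧
        fBex Q (fun t => fAnd (fMem (opair t u) R) (fMem (opair t w) R)) s' := by
    obtain ⟨s₃, hs₃, u, hu⟩ := hcomp s₂ le_rfl
    obtain ⟨s₄, hs₄, w, h⟩ := hu s₃ le_rfl
    exact ⟨s₃, hs₃, u, s₄, hs₄, w, h⟩
  obtain ⟨s₅, hs₅, t, htQ, htu, htw⟩ := ht s₄ le_rfl
  obtain ⟨s₆, hs₆, ξ, α, hα, hxξ, huα⟩ := hS.exists_of_fMem (hu.mono hs₅)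
  obtain ⟨s₇, hs₇, η, β, hβ, hyη, hwβ⟩ := hS.exists_of_fMem (hw.mono (hs₆.trans hs₅))
  -- A coordinate of a condition must belong to `dom Q̇`, so the common extension `t` is replaced by
  -- an element of the domain forced equal to it.
  obtain ⟨s₈, hs₈, j, hj, htj⟩ := (htQ.mono (hs₇.trans hs₆)).exists_fEq
  replace hα := hS.mono _ _ _ _ hα hs₇
  have h75 := hs₇.trans hs₆
  have h72 := ((h75.trans hs₅).trans hs₄).trans hs₃
  have hξη : ξ < η := lt_of_fMem_checkOrd
    (((hxy.mono h72).congr_left (hxξ.mono hs₇)).congr_right hyη)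
  refine ⟨α, β, hlt _ _ _ _ _ _ hα hβ hξη, ⟨s₈, Q.val j, hs₈.trans (hSp _ _ _ hα),
    hs₈.trans (hSp _ _ _ hβ), PName.mem_dom_iff.2 ⟨j, rfl⟩,
    (htQ.mono (hs₈.trans h75)).congr_left htj, ?_, ?_⟩, fun i => ?_⟩
  · exact (htu.mono (hs₈.trans h75)).congr_left
      (fEq_opair htj (huα.mono (hs₈.trans hs₇)))
  · exact (htw.mono (hs₈.trans h75)).congr_left (fEq_opair htj (hwβ.mono hs₈))
  · obtain ⟨c₁, hc₁, z, hz⟩ := hle i s₇ h72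
    obtain ⟨c, hc, z', hz₁, hz₂, hz₃⟩ := hz c₁ le_rfl
    have hc7 := hc.trans hc₁
    have e₁ := hS.exists_of_fMem_of_eq hz₁ (hxξ.mono (hc7.trans hs₇)) (hS.mono _ _ _ _ hα hc7)
    have e₂ := hS.exists_of_fMem_of_eq hz₂ (hyη.mono hc7) (hS.mono _ _ _ _ hβ hc7)
    exact le_of_fMem_leName (hz₃.congr_left (fEq_opair e₁ e₂))

end SeqNames

/-! ### Restriction, extension and gluing of conditions -/

namespace FSIteration

variable {δ : Ordinal.{u}} (I : FSIteration δ)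

theorem restr_restr {α β γ : Ordinal.{u}} (hα : α ≤ δ) (hβ : β ≤ α) (hγ : γ ≤ β) (p : I.P α) :
    I.restr hγ (I.restr hβ p) = I.restr (hγ.trans hβ) p :=
  I.coord_ext γ (hγ.trans (hβ.trans hα)) _ _ fun ξ hξ => by
    rw [I.coord_restr β (hβ.trans hα), I.coord_restr α hα, I.coord_restr α hα]

theorem restr_eq_of_coord_eq {α β : Ordinal.{u}} (hα : α ≤ δ) (hβ : β ≤ α) {p : I.P α}
    {s : I.P β} (h : ∀ ξ (hξ : ξ < β), I.coord p ξ (hξ.trans_le hβ) = I.coord s ξ hξ) :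
    I.restr hβ p = s :=
  I.coord_ext β (hβ.trans hα) _ _ fun ξ hξ => by rw [I.coord_restr α hα, h ξ hξ]

theorem restr_self {α : Ordinal.{u}} (hα : α ≤ δ) (p : I.P α) : I.restr le_rfl p = p :=
  I.restr_eq_of_coord_eq hα le_rfl fun _ _ => rfl

theorem restr_mono {α β : Ordinal.{u}} (hα : α ≤ δ) (hβ : β ≤ α) {p q : I.P α} (h : p ≤ q) :
    I.restr hβ p ≤ I.restr hβ q := by
  rw [I.le_iff β (hβ.trans hα)]
  intro ξ hξ
  rw [I.coord_restr α hα, I.coord_restr α hα, I.restr_restr hα]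
  exact (I.le_iff α hα p q).1 h ξ (hξ.trans_le hβ)

theorem fMem_opair_self {β : Ordinal.{u}} (hβ : β < δ) {x : PName (I.P β)} {p : I.P β}
    (h : fMem x (I.Q β) p) : fMem (opair x x) (I.R β) p :=
  (I.forces_poset β hβ p).2.1 x p le_rfl h

theorem fMem_opair_one {β : Ordinal.{u}} (hβ : β < δ) {x : PName (I.P β)} {p : I.P β}
    (h : fMem x (I.Q β) p) : fMem (opair x (I.one β)) (I.R β) p :=
  (I.forces_poset β hβ p).2.2.2.2 x p le_rfl h

/-- The support of a condition. -/
noncomputable def support {α : Ordinal.{u}} (hα : α ≤ δ) (p : I.P α) : Finset Ordinal.{u} :=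
  (I.finite_support α hα p).toFinset

theorem coord_eq_one {α β : Ordinal.{u}} (hα : α ≤ δ) (hβ : β < α) {p : I.P α}
    (h : β ∉ I.support hα p) : I.coord p β hβ = I.one β := by
  by_contra h'
  exact h ((Set.Finite.mem_toFinset _).2 ⟨hβ, h'⟩)

/-- Extension of a condition of `P β` by one more coordinate. -/
theorem exists_extend {β : Ordinal.{u}} (hβ : β < δ) (s : I.P β) {t : PName (I.P β)}
    (ht : t ∈ (I.Q β).dom) (hs : fMem t (I.Q β) s) :
    ∃ w : I.P (Order.succ β), I.restr (Order.le_succ β) w = s ∧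
      I.coord w β (Order.lt_succ β) = t := by
  classical
  let f : ∀ ξ, ξ < Order.succ β → PName (I.P ξ) := fun ξ hξ =>
    if h : ξ < β then I.coord s ξ h
    else (le_antisymm (Order.lt_succ_iff.1 hξ) (not_lt.1 h)) ▸ t
  have f1 : ∀ ξ (h : ξ < β), f ξ (h.trans (Order.lt_succ β)) = I.coord s ξ h := fun ξ h => by
    simp [f, h]
  have f2 : f β (Order.lt_succ β) = t := by simp [f]
  have hcases : ∀ ξ, ξ < Order.succ β → ξ < β ∨ ξ = β := fun ξ h =>
    (Order.lt_succ_iff.1 h).lt_or_eq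
  have hsδ := Order.succ_le_of_lt hβ
  have hdom : ∀ ξ (hξ : ξ < Order.succ β), f ξ hξ ∈ (I.Q ξ).dom := fun ξ hξ => by
    rcases hcases ξ hξ with h | rfl
    · rw [f1 ξ h]; exact I.coord_mem_dom β hβ.le s ξ h
    · rw [f2]; exact ht
  have hmem : ∀ ξ (hξ : ξ < Order.succ β), ∃ v : I.P ξ,
      (∀ ζ (hζ : ζ < ξ), I.coord v ζ hζ = f ζ (hζ.trans hξ)) ∧ fMem (f ξ hξ) (I.Q ξ) v :=
    fun ξ hξ => by
    rcases hcases ξ hξ with h | rfl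
    · refine ⟨I.restr h.le s, fun ζ hζ => ?_, ?_⟩
      · rw [I.coord_restr β hβ.le, f1]
      · rw [f1 ξ h]; exact I.restr_forces β hβ.le s ξ h
    · refine ⟨s, fun ζ hζ => (f1 ζ hζ).symm, ?_⟩
      rw [f2]; exact hs
  have hfin : {ξ | ∃ hξ : ξ < Order.succ β, f ξ hξ ≠ I.one ξ}.Finite := by
    refine ((I.finite_support β hβ.le s).insert β).subset ?_
    rintro ξ ⟨hξ, h⟩
    rcases hcases ξ hξ with h' | rfl
    · exact Or.inr ⟨h', by rwa [f1 ξ h'] at h⟩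
    · exact Or.inl rfl
  obtain ⟨w, hw⟩ := I.exists_cond _ hsδ f hdom hmem hfin
  refine ⟨w, I.restr_eq_of_coord_eq hsδ _ fun ξ hξ => ?_, ?_⟩
  · rw [hw, f1]
  · rw [hw, f2]

theorem le_succ_iff {β : Ordinal.{u}} (hβ : β < δ) {p q : I.P (Order.succ β)} :
    p ≤ q ↔ I.restr (Order.le_succ β) p ≤ I.restr (Order.le_succ β) q ∧
      fMem (opair (I.coord p β (Order.lt_succ β)) (I.coord q β (Order.lt_succ β))) (I.R β)
        (I.restr (Order.le_succ β) p) := by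
  have hs := Order.succ_le_of_lt hβ
  refine ⟨fun h => ⟨I.restr_mono hs _ h, (I.le_iff _ hs p q).1 h β _⟩, fun ⟨h1, h2⟩ => ?_⟩
  rw [I.le_iff _ hs]
  intro ξ hξ
  rcases (Order.lt_succ_iff.1 hξ).lt_or_eq with h | rfl
  · have := (I.le_iff β hβ.le _ _).1 h1 ξ h
    rwa [I.coord_restr _ hs, I.coord_restr _ hs, I.restr_restr hs] at this
  · exact h2

/-- Conditions whose restrictions to `γ` are compatible and whose supports are disjoint above `γ`
are compatible. -/
theorem compat_of_restr {α γ : Ordinal.{u}} (hα : α ≤ δ) (hγ : γ ≤ α) {p q : I.P α}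
    (h : Compat (I.restr hγ p) (I.restr hγ q))
    (hd : ∀ ξ (hξ : ξ < α), γ ≤ ξ → I.coord p ξ hξ = I.one ξ ∨ I.coord q ξ hξ = I.one ξ) :
    Compat p q := by
  classical
  obtain ⟨s, hsp, hsq⟩ := h
  -- Follow `s` below `γ`; from `γ` on, take whichever coordinate of `p` or `q` may be nontrivial.
  let f : ∀ ξ, ξ < α → PName (I.P ξ) := fun ξ hξ =>
    if h : ξ < γ then I.coord s ξ h
    else if I.coord p ξ hξ = I.one ξ then I.coord q ξ hξ else I.coord p ξ hξ
  have hγδ := hγ.trans hα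
  have f1 : ∀ ξ (h : ξ < γ), f ξ (h.trans_le hγ) = I.coord s ξ h := fun ξ h => by simp [f, h]
  have f2 : ∀ ξ (hξ : ξ < α), γ ≤ ξ →
      (I.coord p ξ hξ = I.one ξ ∧ f ξ hξ = I.coord q ξ hξ) ∨
      (I.coord q ξ hξ = I.one ξ ∧ f ξ hξ = I.coord p ξ hξ) := fun ξ hξ h => by
    by_cases hp : I.coord p ξ hξ = I.one ξ
    · exact Or.inl ⟨hp, by simp [f, h.not_gt, hp]⟩
    · exact Or.inr ⟨(hd ξ hξ h).resolve_left hp, by simp [f, h.not_gt, hp]⟩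
  have hdom : ∀ ξ (hξ : ξ < α), f ξ hξ ∈ (I.Q ξ).dom := fun ξ hξ => by
    rcases lt_or_ge ξ γ with h | h
    · rw [f1 ξ h]; exact I.coord_mem_dom γ hγδ s ξ h
    · rcases f2 ξ hξ h with ⟨-, h'⟩ | ⟨-, h'⟩ <;> rw [h'] <;> exact I.coord_mem_dom α hα _ ξ hξ
  have hfin : {ξ | ∃ hξ : ξ < α, f ξ hξ ≠ I.one ξ}.Finite := by
    refine (((I.finite_support γ hγδ s).union (I.finite_support α hα p)).union
      (I.finite_support α hα q)).subset ?_
    rintro ξ ⟨hξ, h⟩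
    rcases lt_or_ge ξ γ with h' | h'
    · exact Or.inl (Or.inl ⟨h', by rwa [f1 ξ h'] at h⟩)
    · rcases f2 ξ hξ h' with ⟨-, e⟩ | ⟨-, e⟩
      · exact Or.inr ⟨hξ, by rwa [e] at h⟩
      · exact Or.inl (Or.inr ⟨hξ, by rwa [e] at h⟩)
  -- Prefixes of `f` must be shown to be conditions below both restrictions simultaneously: only
  -- then does a prefix force that the next coordinate belongs to the iterand.
  have key : ∀ β (hβ : β ≤ α), ∃ w : I.P β,
      (∀ ξ (hξ : ξ < β), I.coord w ξ hξ = f ξ (hξ.trans_le hβ)) ∧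
        w ≤ I.restr hβ p ∧ w ≤ I.restr hβ q := by
    intro β
    induction β using WellFoundedLT.induction with
    | ind β ih =>
      intro hβ
      have hβδ := hβ.trans hα
      have hmem : ∀ ξ (hξ : ξ < β) (w : I.P ξ),
          (∀ ζ (hζ : ζ < ξ), I.coord w ζ hζ = f ζ ((hζ.trans hξ).trans_le hβ)) →
          w ≤ I.restr (hξ.le.trans hβ) p → w ≤ I.restr (hξ.le.trans hβ) q →
          fMem (f ξ (hξ.trans_le hβ)) (I.Q ξ) w ∧
          fMem (opair (f ξ (hξ.trans_le hβ)) (I.coord p ξ (hξ.trans_le hβ))) (I.R ξ) w ∧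
          fMem (opair (f ξ (hξ.trans_le hβ)) (I.coord q ξ (hξ.trans_le hβ))) (I.R ξ) w := by
        intro ξ hξ w hw hwp hwq
        have hξα := hξ.trans_le hβ
        rcases lt_or_ge ξ γ with h | h
        · obtain rfl : I.restr h.le s = w := I.restr_eq_of_coord_eq hγδ _ fun ζ hζ => by
            rw [hw, f1 ζ (hζ.trans h)]
          rw [f1 ξ h]
          refine ⟨I.restr_forces γ hγδ s ξ h, ?_, ?_⟩
          · simpa only [I.coord_restr α hα] using (I.le_iff γ hγδ _ _).1 hsp ξ h
          · simpa only [I.coord_restr α hα] using (I.le_iff γ hγδ _ _).1 hsq ξ h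
        · have hp := (I.restr_forces α hα p ξ hξα).mono hwp
          have hq := (I.restr_forces α hα q ξ hξα).mono hwq
          have hξδ := hξ.trans_le hβδ
          rcases f2 ξ hξα h with ⟨e1, e2⟩ | ⟨e1, e2⟩
          · rw [e1, e2]
            exact ⟨hq, I.fMem_opair_one hξδ hq, I.fMem_opair_self hξδ hq⟩
          · rw [e1, e2]
            exact ⟨hp, I.fMem_opair_self hξδ hp, I.fMem_opair_one hξδ hp⟩
      obtain ⟨w, hw⟩ := I.exists_cond β hβδ (fun ξ hξ => f ξ (hξ.trans_le hβ))
        (fun ξ hξ => hdom ξ _)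
        (fun ξ hξ => by
          obtain ⟨v, hv, hvp, hvq⟩ := ih ξ hξ (hξ.le.trans hβ)
          exact ⟨v, hv, (hmem ξ hξ v hv hvp hvq).1⟩)
        (hfin.subset fun ξ ⟨hξ, h⟩ => ⟨hξ.trans_le hβ, h⟩)
      refine ⟨w, hw, ?_, ?_⟩
      all_goals
        rw [I.le_iff β hβδ]
        intro ξ hξ
        obtain ⟨v, hv, hvp, hvq⟩ := ih ξ hξ (hξ.le.trans hβ)
        obtain rfl : I.restr hξ.le w = v := I.restr_eq_of_coord_eq hβδ _ fun ζ hζ => by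
          rw [hw, hv]
        rw [hw, I.coord_restr α hα]
        have := hmem ξ hξ _ hv hvp hvq
      · exact this.2.1
      · exact this.2.2
  obtain ⟨w, -, h1, h2⟩ := key α le_rfl
  rw [I.restr_self hα] at h1 h2
  exact ⟨w, h1, h2⟩

/-! ### Induction on the length of the iteration -/

variable {r : Omega1.{u} → ℝ}

theorem appropriate_zero {A : Set ℝ} (hr : IsGoodEnumeration A r) : Appropriate r (I.P 0) := by
  intro n p a
  obtain ⟨α, β, h1, h2⟩ := hr.good n a
  have h : p α = p β := I.coord_ext 0 zero_le _ _ fun ξ hξ => absurd hξ (not_lt_zero)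
  exact ⟨α, β, h1, ⟨p α, le_rfl, h.le⟩, h2⟩

theorem appropriate_succ {β : Ordinal.{u}} (hβ : β < δ) (h : Appropriate r (I.P β))
    (hI : ∀ p : I.P β, fAppropriate r (I.Q β) (I.R β) p) :
    Appropriate r (I.P (Order.succ β)) := by
  intro n p a
  have hs := Order.succ_le_of_lt hβ
  obtain ⟨ξ, η, h1, ⟨s, t, hsξ, hsη, ht, htQ, hξ, hη⟩, h2⟩ := h.hasCCC.exists_forces_compat hI
    (fun α => I.restr (Order.le_succ β) (p α)) (fun α => I.coord (p α) β (Order.lt_succ β))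
    (fun α => I.restr_forces _ hs (p α) β _) a
  obtain ⟨w, rfl, rfl⟩ := I.exists_extend hβ s ht htQ
  exact ⟨ξ, η, h1, ⟨w, (I.le_succ_iff hβ).2 ⟨hsξ, hξ⟩, (I.le_succ_iff hβ).2 ⟨hsη, hη⟩⟩, h2⟩

theorem appropriate_limit {α : Ordinal.{u}} (hα : α ≤ δ) (hlim : Order.IsSuccLimit α)
    (h : ∀ γ < α, Appropriate r (I.P γ)) : Appropriate r (I.P α) := by
  classical
  intro n p a
  obtain ⟨e, K, he, hK⟩ := exists_strictMono_inter_subset fun ξ => I.support hα (p ξ)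
  obtain ⟨γ, hγ, hKγ⟩ : ∃ γ < α, ∀ ξ ∈ K, ξ < α → ξ < γ := by
    -- The supremum of the finitely many successors stays below `α` because `α` is a limit; this is
    -- where finiteness of the root matters.
    refine ⟨(K.filter (· < α)).sup Order.succ, ?_, fun ξ hξ hξα => ?_⟩
    · rw [Finset.sup_lt_iff hlim.bot_lt]
      exact fun ξ hξ => hlim.succ_lt (Finset.mem_filter.1 hξ).2
    · exact (Order.lt_succ ξ).trans_le
        (Finset.le_sup (f := Order.succ) (Finset.mem_filter.2 ⟨hξ, hξα⟩))
  obtain ⟨ξ, η, h1, h2, h3⟩ := h γ hγ n (fun ξ => I.restr hγ.le (p (e ξ))) fun ξ => a (e ξ)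
  refine ⟨e ξ, e η, he h1, I.compat_of_restr hα hγ.le h2 fun ζ hζ hγζ => ?_, h3⟩
  by_contra! hne
  have hζK : ζ ∈ K := hK ξ η h1 (Finset.mem_inter.2
    ⟨by_contra fun h' => hne.1 (I.coord_eq_one hα hζ h'),
      by_contra fun h' => hne.2 (I.coord_eq_one hα hζ h')⟩)
  exact (hKγ ζ hζK hζ).not_ge hγζ

theorem appropriate_of_le {A : Set ℝ} (hr : IsGoodEnumeration A r)
    (hI : ∀ β < δ, ∀ p : I.P β, fAppropriate r (I.Q β) (I.R β) p) (α : Ordinal.{u})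
    (hα : α ≤ δ) : Appropriate r (I.P α) := by
  induction α using WellFoundedLT.induction with
  | ind α ih =>
    rcases Ordinal.zero_or_succ_or_isSuccLimit α with rfl | ⟨β, rfl⟩ | hlim
    · exact I.appropriate_zero hr
    · have hβ := Order.succ_le_iff.1 hα
      exact I.appropriate_succ hβ (ih β (Order.lt_succ β) hβ.le) (hI β hβ)
    · exact I.appropriate_limit hα hlim fun γ hγ => ih γ hγ (hγ.le.trans hα)

end FSIteration

end FSI

theorem mainTheorem8 (A : Set ℝ) (r : FSI.Omega1.{u} → ℝ) (hr : FSI.IsGoodEnumeration A r)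
    (δ : Ordinal.{u}) (I : FSI.FSIteration δ)
    (hI : ∀ β < δ, ∀ p : I.P β, FSI.fAppropriate r (I.Q β) (I.R β) p) :
    FSI.Appropriate r (I.P δ) := by
  exact I.appropriate_of_le hr hI δ le_rfl
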